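/- All graphs are finite, simple and undirected. For integers $k\ge 1$ and $n\ge 3$, let $C^V_{k*[n]}$ denote the graph obtained from $k$ disjoint cycles on $n$ vertices by choosing one vertex in each cycle and identifying the $k$ chosen vertices. A graph is $F$-subgraph-free if it has no (not necessarily induced) subgraph isomorphic to $F$. The treedepth $\mathrm{td}(G)$ of a graph $G$ is the minimum height of a rooted forest $T$ with $V(T)=V(G)$ such that for every edge $uv$ of $G$ both $u$ and $v$ lie on the same root-to-leaf path of $T$ (the height of $T$ is the maximum number of vertices on a root-to-leaf path). For any integers $\ell\geq 3$ and $k\geq 1$, the class of all $C^V_{k*[2\ell]}$-subgraph-free graphs of diameter at most $2$ has bounded treedepth; that is, there is a constant $c$, depending only on $\ell$ and $k$, such that $\mathrm{td}(G)\leq c$ for every $C^V_{k*[2\ell]}$-subgraph-free graph $G$ of diameter at most $2$. -/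

import Mathlib

/-- A rooted forest with vertex set `V`, given by its parent map: roots have no parent, and
following parents always stops, at a root. -/
structure RootedForest (V : Type*) where
  parent : V → Option V
  wf : WellFounded fun u v : V => parent v = some u

namespace RootedForest

variable {V : Type*}

/-- `u` lies on the path from the root to `v` (possibly `u = v`). -/
def IsAncestor (T : RootedForest V) (u v : V) : Prop :=
  Relation.ReflTransGen (fun a b : V => T.parent b = some a) u v

/-- The number of vertices on the path from the root to `v`. -/
noncomputable def depth (T : RootedForest V) (v : V) : ℕ∞ :=
  {u : V | T.IsAncestor u v}.encard

/-- The height of a rooted forest: the maximum number of vertices on a root-to-leaf path. -/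
noncomputable def height (T : RootedForest V) : ℕ∞ :=
  ⨆ v : V, T.depth v

/-- `T` is an elimination forest of `G`: the ends of every edge of `G` lie on a common
root-to-leaf path of `T`, that is, one of them is an ancestor of the other. -/
def IsEliminationForest (T : RootedForest V) (G : SimpleGraph V) : Prop :=
  ∀ u v : V, G.Adj u v → T.IsAncestor u v ∨ T.IsAncestor v u

end RootedForest

/-- The treedepth of `G`: the minimum height of an elimination forest of `G`. -/
noncomputable def treedepth {V : Type*} (G : SimpleGraph V) : ℕ∞ :=
  ⨅ (T : RootedForest V) (_ : T.IsEliminationForest G), T.height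

/-- The map that sends vertex `a` of the `i`-th of `k` disjoint cycles on `n` vertices to its image
after the vertices `0` of all cycles have been identified to the single vertex `none`. -/
def glueZero (k n : ℕ) (i : Fin k) (a : Fin n) : Option (Fin k × {a : Fin n // a.val ≠ 0}) :=
  if h : a.val = 0 then none else some (i, ⟨a, h⟩)

theorem glueZero_injective (k n : ℕ) (i : Fin k) : Function.Injective (glueZero k n i) := by
  intro a b h
  unfold glueZero at h
  split_ifs at h with ha hb hb
  · exact Fin.ext (ha.trans hb.symm)
  · simpa using h

/-- The graph made of `k` cycles on `n` vertices each that share one common vertex `none`. -/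
def sharedVertexCycles (k n : ℕ) : SimpleGraph (Option (Fin k × {a : Fin n // a.val ≠ 0})) where
  Adj x y := ∃ (i : Fin k) (a b : Fin n),
    (SimpleGraph.cycleGraph n).Adj a b ∧ glueZero k n i a = x ∧ glueZero k n i b = y
  symm := ⟨fun _ _ ⟨i, a, b, h, ha, hb⟩ => ⟨i, b, a, h.symm, hb, ha⟩⟩
  loopless := ⟨fun _ ⟨i, _, _, h, ha, hb⟩ =>
    h.ne (glueZero_injective k n i (ha.trans hb.symm))⟩

/-! A graph without long paths has small treedepth: a forest made of edges of `G` with the largest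
possible sum of levels behaves like a depth-first search forest. So it suffices that a long path in
a graph of diameter two yields a vertex `v` with `2l`-cycles through it avoiding any bounded set of
other vertices (`exists_isCycleRich`); `k` cycles sharing only `v` are then picked greedily
(`IsCycleRich.not_free`).

Cut the path into segments of `2l - 1` vertices with ends `a i`, `b i`. By `exists_hubs`, either a
large complete bipartite graph appears, or on a large index set all vertices outside small sets `A`,
`B` see few `a i`, respectively few `b i`, while `A` sees every `a i` and `B` every `b i`. A hub in
both sets closes many disjoint segments into `2l`-cycles. Otherwise diameter two joins almost all
pairs of chosen ends by paths of length two ("links") whose middle vertices have few neighbours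
among the ends, so they are hard to block, and `l` links form a cycle. If `A` is empty, links among
the `a i` suffice. If not, links between the `a i` and the `b i` alternate sides: `l` of them close
up for even `l`, while for odd `l` a hub in `A` replaces one link. -/

/-! ### Treedepth and long paths -/

/-- A rooted forest all of whose parent edges are edges of `G`, with its depth function. -/
structure LeveledForest {V : Type*} (G : SimpleGraph V) where
  parent : V → Option V
  level : V → ℕ
  level_root : ∀ x, parent x = none → level x = 0
  adj_parent : ∀ x y, parent x = some y → G.Adj y x
  level_parent : ∀ x y, parent x = some y → level x = level y + 1

namespace LeveledForest

variable {V : Type*} {G : SimpleGraph V}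

def toRootedForest (T : LeveledForest G) : RootedForest V where
  parent := T.parent
  wf := Subrelation.wf (r := fun u v => T.level u < T.level v)
    (fun {u v} h => by have := T.level_parent v u h; omega) (measure T.level).wf

theorem depth_le (T : LeveledForest G) (v : V) :
    T.toRootedForest.depth v ≤ (T.level v + 1 : ℕ) := by
  have key : ∀ n v, T.level v = n → T.toRootedForest.depth v ≤ (n + 1 : ℕ) := by
    intro n
    induction n with
    | zero =>
      intro v hv
      have : {u : V | T.toRootedForest.IsAncestor u v} ⊆ {v} := by
        intro u hu
        rcases Relation.ReflTransGen.cases_tail hu with h | ⟨w, -, h⟩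
        · exact h.symm
        · have := T.level_parent v w h
          omega
      exact (Set.encard_le_encard this).trans (by simp)
    | succ n ih =>
      intro v hv
      obtain ⟨w, hw⟩ : ∃ w, T.parent v = some w := by
        cases h : T.parent v with
        | none => have := T.level_root v h; omega
        | some w => exact ⟨w, rfl⟩
      have : {u : V | T.toRootedForest.IsAncestor u v} ⊆
          insert v {u : V | T.toRootedForest.IsAncestor u w} := by
        intro u hu
        rcases Relation.ReflTransGen.cases_tail hu with h | ⟨x, hx, h⟩
        · exact Or.inl h.symm
        · obtain rfl : w = x := Option.some.inj (hw.symm.trans h)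
          exact Or.inr hx
      refine (Set.encard_le_encard this).trans ((Set.encard_insert_le _ _).trans ?_)
      have h1 := ih w (by have := T.level_parent v w hw; omega)
      push_cast
      push_cast at h1
      exact add_le_add_left h1 1
  exact key _ v rfl

/-- Following parents from a vertex of level `n` gives a path of `G` on `n + 1` vertices. -/
theorem exists_path (T : LeveledForest G) (x : V) :
    ∃ p : ℕ → V, Set.InjOn p (Set.Iic (T.level x)) ∧
      ∀ j < T.level x, G.Adj (p j) (p (j + 1)) := by
  -- At a root the sequence becomes constant; only indices up to `T.level x` are used.
  let p : ℕ → V := fun n => Nat.rec x (fun _ y => (T.parent y).getD y) n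
  have hstep : ∀ j, p (j + 1) = (T.parent (p j)).getD (p j) := fun _ => rfl
  have hpar : ∀ j, 0 < T.level (p j) → T.parent (p j) = some (p (j + 1)) := by
    intro j hj
    cases h : T.parent (p j) with
    | none => have := T.level_root _ h; omega
    | some w => rw [hstep, h]; rfl
  have hlev : ∀ j ≤ T.level x, T.level (p j) = T.level x - j := by
    intro j
    induction j with
    | zero => intro _; rfl
    | succ j ih =>
      intro hj
      have h1 := ih (by omega)
      have := T.level_parent _ _ (hpar j (by omega))
      omega
  refine ⟨p, ?_, ?_⟩
  · intro i hi j hj hij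
    have h1 := hlev i hi
    have h2 := hlev j hj
    rw [hij] at h1
    simp only [Set.mem_Iic] at hi hj
    omega
  · intro j hj
    have h1 := hlev j hj.le
    exact (T.adj_parent _ _ (hpar j (by omega))).symm

open Classical in
/-- Moving the subtree at `v` below `u`. -/
noncomputable def reparent (T : LeveledForest G) (u v : V) (hadj : G.Adj u v)
    (hvu : ¬ T.toRootedForest.IsAncestor v u) (hle : T.level v ≤ T.level u) :
    LeveledForest G where
  parent := Function.update T.parent v (some u)
  level w := if T.toRootedForest.IsAncestor v w then T.level w + (T.level u + 1 - T.level v)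
    else T.level w
  level_root x hx := by
    have hxv : x ≠ v := by rintro rfl; simp at hx
    rw [Function.update_of_ne hxv] at hx
    rw [if_neg, T.level_root x hx]
    intro h
    rcases Relation.ReflTransGen.cases_tail h with h | ⟨y, -, h⟩
    · exact hxv h
    · have h : T.parent x = some y := h
      simp [hx] at h
  adj_parent x y hx := by
    by_cases hxv : x = v
    · subst hxv
      simp only [Function.update_self, Option.some.injEq] at hx
      exact hx ▸ hadj
    · rw [Function.update_of_ne hxv] at hx
      exact T.adj_parent x y hx
  level_parent x y hx := by
    by_cases hxv : x = v
    · subst hxv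
      simp only [Function.update_self, Option.some.injEq] at hx
      subst hx
      have hrefl : T.toRootedForest.IsAncestor x x := Relation.ReflTransGen.refl
      rw [if_pos hrefl, if_neg hvu]
      omega
    · rw [Function.update_of_ne hxv] at hx
      have hl := T.level_parent x y hx
      have hiff : T.toRootedForest.IsAncestor v x ↔ T.toRootedForest.IsAncestor v y := by
        constructor
        · intro h
          rcases Relation.ReflTransGen.cases_tail h with h | ⟨z, hz, h⟩
          · exact absurd h hxv
          · obtain rfl : y = z := Option.some.inj (hx.symm.trans h)
            exact hz
        · exact fun h => h.tail hx
      simp only [hiff]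
      split_ifs <;> omega

/-- A forest maximising the sum of levels works: if an edge `uv` with `level v ≤ level u` had `v`
not above `u`, hanging the subtree at `v` below `u` would raise the sum. The bound `N` serves only
to make the maximum exist. -/
theorem exists_isEliminationForest [Finite V] (N : ℕ)
    (hN : ∀ (T : LeveledForest G) (x : V), T.level x < N) :
    ∃ T : LeveledForest G, T.toRootedForest.IsEliminationForest G := by
  classical
  have := Fintype.ofFinite V
  let P : ℕ → Prop := fun n => ∃ T : LeveledForest G, ∑ x, T.level x = n
  have hP0 : P 0 := ⟨⟨fun _ => none, fun _ => 0, by simp, by simp, by simp⟩, by simp⟩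
  have hbound : ∀ T : LeveledForest G, ∑ x, T.level x ≤ Fintype.card V * N := fun T =>
    (Finset.sum_le_sum fun x _ => (hN T x).le).trans (by simp)
  obtain ⟨T, hT⟩ : P (Nat.findGreatest P (Fintype.card V * N)) :=
    Nat.findGreatest_spec (Nat.zero_le _) hP0
  have hmax : ∀ T' : LeveledForest G, ∑ x, T'.level x ≤ ∑ x, T.level x := fun T' => by
    rw [hT]
    exact Nat.le_findGreatest (hbound T') ⟨T', rfl⟩
  have key : ∀ u v, G.Adj u v → T.level v ≤ T.level u → T.toRootedForest.IsAncestor v u := by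
    intro u v huv hle
    by_contra hvu
    have h := hmax (T.reparent u v huv hvu hle)
    refine absurd h (not_le.2 (Finset.sum_lt_sum (fun w _ => ?_) ⟨v, Finset.mem_univ v, ?_⟩))
    · simp only [reparent]
      split_ifs <;> omega
    · have hrefl : T.toRootedForest.IsAncestor v v := Relation.ReflTransGen.refl
      simp only [reparent]
      rw [if_pos hrefl]
      omega
  refine ⟨T, fun u v huv => ?_⟩
  rcases le_total (T.level v) (T.level u) with h | h
  · exact Or.inr (key u v huv h)
  · exact Or.inl (key v u huv.symm h)

end LeveledForest

/-- A graph without a path on `N + 1` vertices has treedepth at most `N`. -/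
theorem treedepth_le_of_no_path {V : Type*} [Finite V] (G : SimpleGraph V) (N : ℕ)
    (h : ¬ ∃ p : ℕ → V, Set.InjOn p (Set.Iic N) ∧ ∀ j < N, G.Adj (p j) (p (j + 1))) :
    treedepth G ≤ (N : ℕ∞) := by
  have hN : ∀ (T : LeveledForest G) (x : V), T.level x < N := by
    intro T x
    by_contra hx
    rw [not_lt] at hx
    obtain ⟨p, hp, hadj⟩ := T.exists_path x
    exact h ⟨p, hp.mono (Set.Iic_subset_Iic.2 hx), fun j hj => hadj j (hj.trans_le hx)⟩
  obtain ⟨T, hT⟩ := LeveledForest.exists_isEliminationForest N hN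
  refine (iInf₂_le T.toRootedForest hT).trans (iSup_le fun v => (T.depth_le v).trans ?_)
  exact_mod_cast hN T v

/-! ### Cycles sharing one vertex -/

/-- There is a cycle of length `n` through `v` whose other vertices lie outside `F`. -/
def HasCycleAvoiding {V : Type*} (G : SimpleGraph V) (v : V) (n : ℕ) (F : Finset V) : Prop :=
  ∃ L : List V, L.length + 1 = n ∧ L.Nodup ∧ (∀ x ∈ L, x ∉ F) ∧
    (v :: (L ++ [v])).IsChain G.Adj

/-- Cycles of length `n` through `v` exist even when any `f` vertices are forbidden. -/
def IsCycleRich {V : Type*} (G : SimpleGraph V) (n f : ℕ) (v : V) : Prop :=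
  ∀ F : Finset V, v ∈ F → F.card ≤ f → HasCycleAvoiding G v n F

theorem IsCycleRich.exists_disjoint {V : Type*} {G : SimpleGraph V} {n : ℕ} {v : V} (k : ℕ)
    (h : IsCycleRich G n (k * n + 1) v) :
    ∃ L : ℕ → List V, (∀ i < k, (L i).length + 1 = n ∧ (L i).Nodup ∧ v ∉ L i ∧
      (v :: (L i ++ [v])).IsChain G.Adj) ∧
      ∀ i < k, ∀ j < i, List.Disjoint (L j) (L i) := by
  classical
  -- Greedy choice: `F` collects `v` and the vertices of the cycles found so far.
  have key : ∀ m ≤ k, ∃ (L : ℕ → List V) (F : Finset V), v ∈ F ∧ F.card ≤ m * n + 1 ∧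
      (∀ i < m, (L i).length + 1 = n ∧ (L i).Nodup ∧ v ∉ L i ∧
      (v :: (L i ++ [v])).IsChain G.Adj ∧ ∀ x ∈ L i, x ∈ F) ∧
      ∀ i < m, ∀ j < i, List.Disjoint (L j) (L i) := by
    intro m
    induction m with
    | zero => intro _; exact ⟨fun _ => [], {v}, by simp, by simp, by simp, by simp⟩
    | succ m ih =>
      intro hm
      obtain ⟨L, F, hvF, hF, hL, hdisj⟩ := ih (by omega)
      have hmk : m * n ≤ k * n := Nat.mul_le_mul_right n (by omega)
      obtain ⟨C, hlen, hnd, hCF, hch⟩ := h F hvF (by omega)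
      refine ⟨Function.update L m C, F ∪ C.toFinset, Finset.mem_union_left _ hvF, ?_, ?_, ?_⟩
      · have h1 := Finset.card_union_le F C.toFinset
        have h2 := C.toFinset_card_le
        have h3 : (m + 1) * n = m * n + n := by ring
        omega
      · intro i hi
        rcases Nat.lt_succ_iff_lt_or_eq.1 hi with hi | rfl
        · rw [Function.update_of_ne hi.ne]
          obtain ⟨a, b, c, d, e⟩ := hL i hi
          exact ⟨a, b, c, d, fun x hx => Finset.mem_union_left _ (e x hx)⟩
        · rw [Function.update_self]
          exact ⟨hlen, hnd, fun hv => hCF v hv hvF, hch,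
            fun x hx => Finset.mem_union_right _ (List.mem_toFinset.2 hx)⟩
      · intro i hi j hj
        rcases Nat.lt_succ_iff_lt_or_eq.1 hi with hi | rfl
        · rw [Function.update_of_ne hi.ne, Function.update_of_ne (hj.trans hi).ne]
          exact hdisj i hi j hj
        · rw [Function.update_self, Function.update_of_ne hj.ne]
          exact fun x hx hx' => hCF x hx' ((hL j hj).2.2.2.2 x hx)
  obtain ⟨L, F, -, -, hL, hd⟩ := key k le_rfl
  exact ⟨L, fun i hi => ⟨(hL i hi).1, (hL i hi).2.1, (hL i hi).2.2.1, (hL i hi).2.2.2.1⟩, hd⟩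

/-- A vertex that is rich in cycles of length `n` is the centre of `k` cycles sharing only it. -/
theorem IsCycleRich.not_free {V : Type*} {G : SimpleGraph V} {n k : ℕ} {v : V} (hn : 2 ≤ n)
    (h : IsCycleRich G n (k * n + 1) v) : ¬ (sharedVertexCycles k n).Free G := by
  obtain ⟨L, hL, hd⟩ := h.exists_disjoint k
  rw [SimpleGraph.not_free]
  let c : Fin k → ℕ → V := fun i j => (v :: (L i ++ [v])).getD j v
  have hlen : ∀ i : Fin k, (v :: (L i ++ [v])).length = n + 1 := fun i => by
    have := (hL i i.2).1
    simp only [List.length_cons, List.length_append, List.length_nil]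
    omega
  have hadj : ∀ i, ∀ j < n, G.Adj (c i j) (c i (j + 1)) := by
    intro i j hj
    have h1 := List.isChain_iff_getElem.1 (hL i i.2).2.2.2 j (by rw [hlen]; omega)
    simp only [c]
    rw [List.getD_eq_getElem _ _ (by rw [hlen]; omega),
      List.getD_eq_getElem _ _ (by rw [hlen]; omega)]
    exact h1
  have hc0 : ∀ i, c i 0 = v := fun _ => rfl
  have hcn : ∀ i, c i n = v := by
    intro i
    obtain ⟨m, rfl⟩ : ∃ m, n = m + 1 := ⟨n - 1, by omega⟩
    have := (hL i i.2).1
    simp only [c, List.getD_cons_succ]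
    rw [List.getD_append_right _ _ _ _ (by omega)]
    simp [show m - (L i).length = 0 by omega]
  have hget : ∀ (i : Fin k) (j : ℕ) (hj : j < n) (h0 : j ≠ 0),
      ∃ h' : j - 1 < (L i).length, c i j = (L i)[j - 1] := by
    intro i j hj h0
    obtain ⟨m, rfl⟩ : ∃ m, j = m + 1 := ⟨j - 1, by omega⟩
    have := (hL i i.2).1
    refine ⟨by omega, ?_⟩
    simp only [c, List.getD_cons_succ]
    rw [List.getD_append _ _ _ _ (by omega), List.getD_eq_getElem _ _ (by omega)]
    simp
  have hcyc : ∀ i (a b : Fin n), (SimpleGraph.cycleGraph n).Adj a b → G.Adj (c i a) (c i b) := by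
    have aux : ∀ i (a b : Fin n), (b - a).val = 1 → G.Adj (c i a) (c i b) := by
      intro i a b hab
      rw [Fin.sub_def] at hab
      simp only at hab
      have ha := a.2
      have hb := b.2
      by_cases hlt : a.val < b.val
      · rw [show n - a.val + b.val = n + (b.val - a.val) by omega, Nat.add_mod_left,
          Nat.mod_eq_of_lt (by omega)] at hab
        rw [show b.val = a.val + 1 by omega]
        exact hadj i a ha
      · by_cases heq : a.val = b.val
        · rw [show n - a.val + b.val = n by omega, Nat.mod_self] at hab
          omega
        -- The wrap-around edge from `n - 1` to `0`: position `n` of the closed list is again `v`.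
        · rw [Nat.mod_eq_of_lt (by omega)] at hab
          rw [show b.val = 0 by omega, hc0, ← hcn i]
          have := hadj i a ha
          rwa [show a.val + 1 = n by omega] at this
    intro i a b hab
    rcases SimpleGraph.cycleGraph_adj'.1 hab with h | h
    · exact (aux i b a h).symm
    · exact aux i a b h
  let φ : Option (Fin k × {a : Fin n // a.val ≠ 0}) → V
    | none => v
    | some x => c x.1 x.2.1
  have hφ : ∀ i a, φ (glueZero k n i a) = c i a := by
    intro i a
    unfold glueZero
    split_ifs with h
    · rw [h, hc0]
    · rfl
  have hv : ∀ x : Fin k × {a : Fin n // a.val ≠ 0}, c x.1 x.2.1 ≠ v := by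
    intro x hx
    obtain ⟨h', h1⟩ := hget x.1 x.2.1 x.2.1.2 x.2.2
    rw [h1] at hx
    exact (hL x.1 x.1.2).2.2.1 (hx ▸ List.getElem_mem h')
  refine ⟨⟨⟨φ, ?_⟩, ?_⟩⟩
  · rintro x y ⟨i, a, b, hab, rfl, rfl⟩
    rw [hφ, hφ]
    exact hcyc i a b hab
  · rintro (_ | x) (_ | y) hxy
    · rfl
    · exact absurd hxy.symm (hv y)
    · exact absurd hxy (hv x)
    · have hxy : c x.1 x.2.1 = c y.1 y.2.1 := hxy
      obtain ⟨h1, e1⟩ := hget x.1 x.2.1 x.2.1.2 x.2.2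
      obtain ⟨h2, e2⟩ := hget y.1 y.2.1 y.2.1.2 y.2.2
      rw [e1, e2] at hxy
      have hi : x.1 = y.1 := by
        have m1 := List.getElem_mem h1
        have m2 := List.getElem_mem h2
        rw [hxy] at m1
        rcases lt_trichotomy x.1 y.1 with hlt | heq | hlt
        · exact (hd y.1 y.1.2 x.1 hlt m1 m2).elim
        · exact heq
        · exact (hd x.1 x.1.2 y.1 hlt m2 m1).elim
      obtain ⟨i, a, ha⟩ := x
      obtain ⟨j, b, hb⟩ := y
      obtain rfl : i = j := hi
      have := (List.Nodup.getElem_inj_iff (hL i i.2).2.1).1 hxy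
      simp only at this ha hb
      have : a = b := Fin.ext (by omega)
      subst this
      rfl

/-! ### Paths made of links, and sparse pairs -/

/-- Every vertex of `X` has a path of length two to a vertex of `Y`, avoiding any `f` vertices. -/
def IsLinkRich {V : Type*} (G : SimpleGraph V) (f : ℕ) (X Y : Finset V) : Prop :=
  ∀ u ∈ X, ∀ F : Finset V, F.card ≤ f → ∃ z w, z ∉ F ∧ w ∈ Y ∧ w ∉ F ∧ G.Adj u z ∧ G.Adj z w

/-- Each link adds its two new vertices to the forbidden set, hence the budget `2 * r`. The start
`u` is avoided later only if `F` contains it. -/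
theorem exists_linkPath {V : Type*} {G : SimpleGraph V} {f : ℕ} {S : ℕ → Finset V}
    (hS : ∀ i, IsLinkRich G f (S i) (S (i + 1))) (r : ℕ) :
    ∀ (i : ℕ) (u : V) (F : Finset V), u ∈ S i → F.card + 2 * r ≤ f →
      ∃ (L : List V) (w : V), w ∈ S (i + r) ∧ L.length = 2 * r ∧ L.Nodup ∧ (∀ x ∈ L, x ∉ F) ∧
        (u :: L).IsChain G.Adj ∧ (u :: L).getLast? = some w := by
  classical
  induction r with
  | zero => intro i u F hu _; exact ⟨[], u, hu, rfl, by simp, by simp, by simp, rfl⟩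
  | succ r ih =>
    intro i u F hu hF
    obtain ⟨z, w, hz, hwS, hw, huz, hzw⟩ := hS i u hu F (by omega)
    have hcard : (insert z (insert w F)).card ≤ F.card + 2 :=
      (Finset.card_insert_le _ _).trans (Nat.add_le_add_right (Finset.card_insert_le _ _) 1)
    obtain ⟨L, x, hx, hlen, hnd, hav, hch, hlast⟩ :=
      ih (i + 1) w (insert z (insert w F)) hwS (by omega)
    refine ⟨z :: w :: L, x, by rwa [show i + (r + 1) = i + 1 + r by omega], by simp; omega,
      ?_, ?_, ?_, ?_⟩
    · have hzL : z ∉ L := fun h => hav z h (by simp)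
      have hwL : w ∉ L := fun h => hav w h (by simp)
      simp [hzL, hwL, hnd, hzw.ne]
    · intro y hy
      rcases List.mem_cons.1 hy with rfl | hy
      · exact hz
      rcases List.mem_cons.1 hy with rfl | hy
      · exact hw
      · exact fun h => hav y hy (by simp [h])
    · simp only [List.isChain_cons_cons]
      exact ⟨huz, hzw, hch⟩
    · rw [List.getLast?_cons_cons, List.getLast?_cons_cons]
      exact hlast

open Classical in
/-- Vertices of `Z` have few neighbours in `Y`, and every vertex of `X` has a common neighbour in
`Z` with almost every vertex of `Y`. -/
structure IsSparse {V : Type*} (G : SimpleGraph V) (Z : Set V) (d : ℕ) (X Y : Finset V) : Prop where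
  card_adj : ∀ z ∈ Z, (Y.filter fun y => G.Adj z y).card ≤ d
  card_unlinked : ∀ x ∈ X, (Y.filter fun y => ¬ ∃ z ∈ Z, G.Adj x z ∧ G.Adj z y).card ≤ d

namespace IsSparse

variable {V : Type*} {G : SimpleGraph V} {Z : Set V} {d : ℕ} {X Y : Finset V}

/-- Almost all vertices of `Y` are linked to all of `U` by vertices outside `F`. -/
theorem exists_linked (h : IsSparse G Z d X Y) (U F : Finset V) (hU : U ⊆ X) :
    ∃ Y' ⊆ Y, Y.card ≤ Y'.card + (F.card + d * U.card + d * F.card) ∧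
      ∀ y ∈ Y', y ∉ F ∧ ∀ u ∈ U, ∃ z ∈ Z, z ∉ F ∧ G.Adj u z ∧ G.Adj z y := by
  classical
  let B1 := U.biUnion fun u => Y.filter fun y => ¬ ∃ z ∈ Z, G.Adj u z ∧ G.Adj z y
  let B2 := (F.filter (· ∈ Z)).biUnion fun z => Y.filter fun y => G.Adj z y
  have h1 : B1.card ≤ d * U.card := by
    rw [mul_comm]
    exact Finset.card_biUnion_le_card_mul _ _ _ fun u hu => h.card_unlinked u (hU hu)
  have h2 : B2.card ≤ d * F.card := by
    refine (Finset.card_biUnion_le_card_mul _ _ d fun z hz =>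
      h.card_adj z (Finset.mem_filter.1 hz).2).trans ?_
    rw [mul_comm]
    exact Nat.mul_le_mul_left _ (Finset.card_filter_le _ _)
  refine ⟨Y \ (F ∪ B1 ∪ B2), Finset.sdiff_subset, ?_, ?_⟩
  · have a1 := Finset.card_le_card_sdiff_add_card (s := Y) (t := F ∪ B1 ∪ B2)
    have a2 := Finset.card_union_le (F ∪ B1) B2
    have a3 := Finset.card_union_le F B1
    omega
  · intro y hy
    simp only [Finset.mem_sdiff, Finset.mem_union, not_or] at hy
    obtain ⟨hyY, ⟨hyF, hy1⟩, hy2⟩ := hy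
    refine ⟨hyF, fun u hu => ?_⟩
    by_contra hcon
    by_cases hl : ∃ z ∈ Z, G.Adj u z ∧ G.Adj z y
    · obtain ⟨z, hz, huz, hzy⟩ := hl
      have hzF : z ∈ F := by
        by_contra hzF
        exact hcon ⟨z, hz, hzF, huz, hzy⟩
      exact hy2 (Finset.mem_biUnion.2 ⟨z, Finset.mem_filter.2 ⟨hzF, hz⟩,
        Finset.mem_filter.2 ⟨hyY, hzy⟩⟩)
    · exact hy1 (Finset.mem_biUnion.2 ⟨u, hu, Finset.mem_filter.2 ⟨hyY, hl⟩⟩)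

theorem isLinkRich (h : IsSparse G Z d X Y) {f : ℕ} (hY : f + d + d * f < Y.card) :
    IsLinkRich G f X Y := by
  intro u hu F hF
  obtain ⟨Y', hY', hcard, hgood⟩ := h.exists_linked {u} F (by simpa using hu)
  have h1 : d * F.card ≤ d * f := Nat.mul_le_mul_left _ hF
  rw [Finset.card_singleton] at hcard
  obtain ⟨y, hy⟩ := Finset.card_pos.1 (show 0 < Y'.card by omega)
  obtain ⟨hyF, hl⟩ := hgood y hy
  obtain ⟨z, -, hzF, huz, hzy⟩ := hl u (by simp)
  exact ⟨z, y, hzF, hY' hy, hyF, huz, hzy⟩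

/-- A path of length six between given vertices of `Y` and `X`. -/
theorem exists_path_six (hXY : IsSparse G Z d X Y) (hYX : IsSparse G Z d Y X) {f : ℕ}
    (hX : f + d + d * f + d < X.card)
    (hY : (f + 2 * (d + 1)) + d * (d + 2) + d * (f + 2 * (d + 1)) < Y.card)
    {u v : V} (hu : u ∈ Y) (hv : v ∈ X) (F : Finset V) (hF : F.card ≤ f) :
    ∃ L : List V, L.length = 5 ∧ L.Nodup ∧ (∀ x ∈ L, x ∉ F) ∧
      (u :: (L ++ [v])).IsChain G.Adj := by
  classical
  obtain ⟨X', hX', hcard, hgood⟩ := hYX.exists_linked {u} F (by simpa using hu)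
  have h1 : d * F.card ≤ d * f := Nat.mul_le_mul_left _ hF
  rw [Finset.card_singleton] at hcard
  -- Since a vertex of `Z` has at most `d` neighbours in `X`, among `d + 1` candidates one is not
  -- adjacent to the middle vertex `z₃` chosen below. This forces `z₂ ≠ z₃`.
  obtain ⟨P, hPX', hP⟩ := Finset.exists_subset_card_eq (show d + 1 ≤ X'.card by omega)
  have hlink : ∀ y ∈ P, ∃ z, z ∉ F ∧ G.Adj u z ∧ G.Adj z y := fun y hy => by
    obtain ⟨z, -, hz⟩ := (hgood y (hPX' hy)).2 u (by simp)
    exact ⟨z, hz⟩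
  choose! g hgF hug hgy using hlink
  have hPF : ∀ y ∈ P, y ∉ F := fun y hy => (hgood y (hPX' hy)).1
  let F' := F ∪ P ∪ P.image g
  have hF' : F'.card ≤ f + 2 * (d + 1) := by
    have a1 := Finset.card_union_le (F ∪ P) (P.image g)
    have a2 := Finset.card_union_le F P
    have a3 := Finset.card_image_le (s := P) (f := g)
    change (F ∪ P ∪ P.image g).card ≤ _
    omega
  have hPX : P ⊆ X := hPX'.trans hX'
  -- The next vertex `x` is linked to `v` and to all of `P` at once, so `y` may be chosen after
  -- `z₃`.
  obtain ⟨Y', hY', hcard', hgood'⟩ := hXY.exists_linked (insert v P) F'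
    (Finset.insert_subset hv hPX)
  have h2 : d * F'.card ≤ d * (f + 2 * (d + 1)) := Nat.mul_le_mul_left _ hF'
  have h3 : d * (insert v P).card ≤ d * (d + 2) :=
    Nat.mul_le_mul_left _ ((Finset.card_insert_le _ _).trans (by omega))
  obtain ⟨x, hx⟩ := Finset.card_pos.1 (show 0 < Y'.card by omega)
  obtain ⟨hxF', hl⟩ := hgood' x hx
  obtain ⟨z₃, hz₃Z, hz₃F', hvz₃, hz₃x⟩ := hl v (by simp)
  obtain ⟨y, hyP, hyz₃⟩ : ∃ y ∈ P, ¬ G.Adj z₃ y := by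
    by_contra! hcon
    have : P ⊆ X.filter fun y => G.Adj z₃ y := fun y hy =>
      Finset.mem_filter.2 ⟨hPX hy, hcon y hy⟩
    have a1 := Finset.card_le_card this
    have a2 := hYX.card_adj z₃ hz₃Z
    omega
  obtain ⟨z₂, -, hz₂F', hyz₂, hz₂x⟩ := hl y (Finset.mem_insert_of_mem hyP)
  have hyF' : y ∈ F' := by simp [F', hyP]
  have hz₁F' : g y ∈ F' := Finset.mem_union_right _ (Finset.mem_image_of_mem g hyP)
  have hFF' : F ⊆ F' := fun a ha => by simp [F', ha]
  have hne : ∀ {a b}, a ∈ F' → b ∉ F' → a ≠ b := fun ha hb hab => hb (hab ▸ ha)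
  refine ⟨[g y, y, z₂, x, z₃], rfl, ?_, ?_, ?_⟩
  · simp only [List.nodup_cons, List.mem_cons, List.not_mem_nil, or_false, not_or]
    refine ⟨⟨(hgy y hyP).ne, hne hz₁F' hz₂F', hne hz₁F' hxF', hne hz₁F' hz₃F'⟩,
      ⟨hyz₂.ne, hne hyF' hxF', hne hyF' hz₃F'⟩, ⟨hz₂x.ne, ?_⟩, hz₃x.ne', not_false,
      List.nodup_nil⟩
    rintro rfl
    exact hyz₃ hyz₂.symm
  · intro a ha
    simp only [List.mem_cons, List.not_mem_nil, or_false] at ha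
    rcases ha with rfl | rfl | rfl | rfl | rfl
    · exact hgF y hyP
    · exact hPF _ hyP
    · exact fun h => hz₂F' (hFF' h)
    · exact fun h => hxF' (hFF' h)
    · exact fun h => hz₃F' (hFF' h)
  · simp only [List.cons_append, List.nil_append, List.isChain_cons_cons, List.isChain_singleton,
      and_true]
    exact ⟨hug y hyP, hgy y hyP, hyz₂, hz₂x, hz₃x.symm, hvz₃.symm⟩

/-- The number of vertices that a sparse pair needs to be rich in cycles. -/
def bound (f d : ℕ) : ℕ := (f + 2 * (d + 1)) + d * (d + 2) + d * (f + 2 * (d + 1))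

theorem le_bound (f d : ℕ) : f + d + d * f + d ≤ bound f d := by
  have h : d * f ≤ d * (f + 2 * (d + 1)) := Nat.mul_le_mul_left _ (by omega)
  unfold bound
  omega

theorem isLinkRich_alternate (hXY : IsSparse G Z d X Y) (hYX : IsSparse G Z d Y X) {f : ℕ}
    (hX : bound f d < X.card) (hY : bound f d < Y.card) (i : ℕ) :
    IsLinkRich G f (if Even i then X else Y) (if Even (i + 1) then X else Y) := by
  have := le_bound f d
  by_cases hi : Even i
  · rw [if_pos hi, if_neg (by simpa [Nat.even_add_one] using hi)]
    exact hXY.isLinkRich (by omega)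
  · rw [if_neg hi, if_pos (by simpa [Nat.even_add_one] using hi)]
    exact hYX.isLinkRich (by omega)

/-- A chain of `l - 3` links is greedy; closing it up needs prescribed ends, which costs the three
links of `exists_path_six`. Those lead from `Y` to `X`, so the chain must end in `Y`: either `l - 3`
is odd or the two sides agree. -/
theorem isCycleRich (hXY : IsSparse G Z d X Y) (hYX : IsSparse G Z d Y X) {l f : ℕ} (hl : 3 ≤ l)
    (hX : bound (f + 2 * l) d < X.card) (hY : bound (f + 2 * l) d < Y.card)
    (hpar : Even l ∨ X = Y) {v : V} (hv : v ∈ X) : IsCycleRich G (2 * l) f v := by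
  classical
  intro F hvF hF
  obtain ⟨r, rfl⟩ : ∃ r, l = r + 3 := ⟨l - 3, by omega⟩
  have hb := le_bound (f + 2 * (r + 3)) d
  obtain ⟨L, w, hw, hlen, hnd, hav, hch, hlast⟩ :=
    exists_linkPath (isLinkRich_alternate hXY hYX hX hY) r 0 v F (by simpa using hv) (by omega)
  have hwY : w ∈ Y := by
    rcases hpar with h | rfl
    · rw [if_neg] at hw
      · exact hw
      · rw [zero_add]
        intro h'
        rw [Nat.even_add] at h
        exact absurd (h.1 h') (by decide)
    · simpa using hw
  have hcard : (F ∪ L.toFinset).card ≤ f + 2 * (r + 3) := by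
    have a1 := Finset.card_union_le F L.toFinset
    have a2 := L.toFinset_card_le
    omega
  obtain ⟨M, hMlen, hMnd, hMav, hMch⟩ :=
    hXY.exists_path_six hYX (by omega) hY hwY hv (F ∪ L.toFinset) hcard
  refine ⟨L ++ M, by simp; omega, ?_, ?_, ?_⟩
  · refine List.nodup_append'.2 ⟨hnd, hMnd, fun x hx hx' => hMav x hx' ?_⟩
    exact Finset.mem_union_right _ (List.mem_toFinset.2 hx)
  · intro x hx
    rcases List.mem_append.1 hx with hx | hx
    · exact hav x hx
    · exact fun h => hMav x hx (Finset.mem_union_left _ h)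
  · rw [show v :: (L ++ M ++ [v]) = (v :: L) ++ (M ++ [v]) by simp]
    refine hch.append hMch.tail ?_
    intro x hx y hy
    rw [hlast] at hx
    obtain rfl : w = x := by simpa using hx
    exact hMch.rel_head? hy

/-- A vertex adjacent to all of `X` closes link paths of even length into cycles. -/
theorem isCycleRich_of_hub (hXY : IsSparse G Z d X Y) (hYX : IsSparse G Z d Y X) {l f : ℕ}
    (hX : bound (f + 2 * l) d < X.card) (hY : bound (f + 2 * l) d < Y.card)
    (hpar : Odd l) {v : V} (hv : ∀ x ∈ X, G.Adj v x) : IsCycleRich G (2 * l) f v := by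
  classical
  intro F hvF hF
  obtain ⟨r, rfl⟩ : ∃ r, l = r + 1 := ⟨l - 1, by have := hpar.pos; omega⟩
  have hr : Even r := by simpa [Nat.odd_add_one] using hpar
  have hb := le_bound (f + 2 * (r + 1)) d
  -- The `l - 1` links starting at `a` are even in number, so they return to `X`; two edges at the
  -- hub complete the length `2l`.
  obtain ⟨a, haX, haF⟩ := Finset.exists_mem_notMem_of_card_lt_card (s := F) (t := X) (by omega)
  obtain ⟨L, w, hw, hlen, hnd, hav, hch, hlast⟩ :=
    exists_linkPath (isLinkRich_alternate hXY hYX hX hY) r 0 a (insert a F) (by simpa using haX)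
      (by have := Finset.card_insert_le a F; omega)
  have hwX : w ∈ X := by simpa [hr] using hw
  refine ⟨a :: L, by simp; omega, ?_, ?_, ?_⟩
  · exact List.nodup_cons.2 ⟨fun h => hav a h (by simp), hnd⟩
  · intro x hx
    rcases List.mem_cons.1 hx with rfl | hx
    · exact haF
    · exact fun h => hav x hx (Finset.mem_insert_of_mem h)
  · rw [List.cons_append, List.isChain_cons_cons, ← List.cons_append]
    refine ⟨hv a haX, hch.append (by simp) ?_⟩
    intro x hx y hy
    rw [hlast] at hx
    obtain rfl : w = x := by simpa using hx
    obtain rfl : v = y := by simpa using hy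
    exact (hv w hwX).symm

end IsSparse

/-! ### Complete bipartite graphs and hubs -/

/-- Complete bipartite subgraphs are rich in cycles. -/
theorem isCycleRich_of_complete {V : Type*} {G : SimpleGraph V} {X Y : Finset V} {l f : ℕ}
    (hl : 1 ≤ l) (hX : f + 2 * l < X.card) (hY : f + 2 * l < Y.card)
    (h : ∀ x ∈ X, ∀ y ∈ Y, G.Adj x y) {v : V} (hv : v ∈ X) : IsCycleRich G (2 * l) f v := by
  classical
  intro F hvF hF
  obtain ⟨r, rfl⟩ : ∃ r, l = r + 1 := ⟨l - 1, by omega⟩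
  have hrich : IsLinkRich G (f + 2 * (r + 1)) X X := by
    intro u hu F hF
    obtain ⟨z, hz, hzF⟩ := Finset.exists_mem_notMem_of_card_lt_card (hF.trans_lt hY)
    obtain ⟨w, hw, hwF⟩ := Finset.exists_mem_notMem_of_card_lt_card (hF.trans_lt hX)
    exact ⟨z, w, hzF, hw, hwF, h u hu z hz, (h w hw z hz).symm⟩
  obtain ⟨L, w, hw, hlen, hnd, hav, hch, hlast⟩ :=
    exists_linkPath (S := fun _ => X) (fun _ => hrich) r 0 v F hv (by omega)
  have hcard : (F ∪ L.toFinset).card ≤ f + 2 * (r + 1) := by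
    have a1 := Finset.card_union_le F L.toFinset
    have a2 := L.toFinset_card_le
    omega
  obtain ⟨z, hz, hzF⟩ := Finset.exists_mem_notMem_of_card_lt_card (hcard.trans_lt hY)
  simp only [Finset.mem_union, List.mem_toFinset, not_or] at hzF
  refine ⟨L ++ [z], by simp; omega, ?_, ?_, ?_⟩
  · refine List.nodup_append'.2 ⟨hnd, by simp, fun x hx hx' => hzF.2 ?_⟩
    obtain rfl : x = z := by simpa using hx'
    exact hx
  · intro x hx
    rcases List.mem_append.1 hx with hx | hx
    · exact hav x hx
    · obtain rfl : x = z := by simpa using hx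
      exact hzF.1
  · rw [show v :: (L ++ [z] ++ [v]) = (v :: L) ++ [z, v] by simp]
    refine hch.append (by simpa using (h v hv z hz).symm) ?_
    intro x hx y hy
    rw [hlast] at hx
    obtain rfl : w = x := by simpa using hx
    obtain rfl : z = y := by simpa using hy
    exact h w hw z hz

open Classical in
/-- A pair of sequences indexed by a large set `I` either has a complete bipartite graph at one of
them, or can be restricted so that all vertices outside two small sets `A`, `B` of hubs have few
neighbours. -/
theorem exists_hubs (t : ℕ) (g : ℕ → ℕ) (m : ℕ) : ∃ n : ℕ, ∀ (V : Type*) (G : SimpleGraph V)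
    (a b : ℕ → V) (I : Finset ℕ) (A B : Finset V), A.card + B.card + m = 2 * t → n ≤ I.card →
    (∀ z ∈ A, ∀ i ∈ I, G.Adj z (a i)) → (∀ z ∈ B, ∀ i ∈ I, G.Adj z (b i)) →
    (∃ (H : Finset V) (J : Finset ℕ), t ≤ H.card ∧ J ⊆ I ∧ t ≤ J.card ∧
      ((∀ z ∈ H, ∀ i ∈ J, G.Adj z (a i)) ∨ ∀ z ∈ H, ∀ i ∈ J, G.Adj z (b i))) ∨
    ∃ (d : ℕ) (J : Finset ℕ) (A B : Finset V), J ⊆ I ∧ g d ≤ J.card ∧ A.card ≤ t ∧ B.card ≤ t ∧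
      (∀ z ∈ A, ∀ i ∈ J, G.Adj z (a i)) ∧ (∀ z ∈ B, ∀ i ∈ J, G.Adj z (b i)) ∧
      (∀ z ∉ A, (J.filter fun i => G.Adj z (a i)).card ≤ d) ∧
      ∀ z ∉ B, (J.filter fun i => G.Adj z (b i)).card ≤ d := by
  -- Here `m` counts the hubs that may still be added; at `m = 0` one of the two sets has at least
  -- `t`.
  induction m with
  | zero =>
    refine ⟨t, fun V G a b I A B hm hI hA hB => Or.inl ?_⟩
    by_cases ht : t ≤ A.card
    · exact ⟨A, I, ht, Finset.Subset.refl _, hI, Or.inl hA⟩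
    · exact ⟨B, I, by omega, Finset.Subset.refl _, hI, Or.inr hB⟩
  | succ m ih =>
    obtain ⟨n, hn⟩ := ih
    refine ⟨max t (g n), fun V G a b I A B hm hI hA hB => ?_⟩
    rw [max_le_iff] at hI
    by_cases htA : t ≤ A.card
    · exact Or.inl ⟨A, I, htA, Finset.Subset.refl _, hI.1, Or.inl hA⟩
    by_cases htB : t ≤ B.card
    · exact Or.inl ⟨B, I, htB, Finset.Subset.refl _, hI.1, Or.inr hB⟩
    have restrict : ∀ (P : ℕ → Prop) (A' B' : Finset V), A'.card + B'.card + m = 2 * t →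
        n ≤ (I.filter P).card → (∀ z ∈ A', ∀ i ∈ I.filter P, G.Adj z (a i)) →
        (∀ z ∈ B', ∀ i ∈ I.filter P, G.Adj z (b i)) → _ :=
      fun P A' B' => hn V G a b (I.filter P) A' B'
    -- A vertex with more than `n` neighbours becomes a hub on the indices it sees; if there is none
    -- on either side, `d = n` works.
    by_cases hzA : ∃ z ∉ A, n < (I.filter fun i => G.Adj z (a i)).card
    · obtain ⟨z, hz, hcard⟩ := hzA
      have := restrict (fun i => G.Adj z (a i)) (insert z A) B
        (by rw [Finset.card_insert_of_notMem hz]; omega) hcard.le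
        (fun x hx i hi => by
          rw [Finset.mem_filter] at hi
          rcases Finset.mem_insert.1 hx with rfl | hx
          · exact hi.2
          · exact hA x hx i hi.1)
        (fun x hx i hi => hB x hx i (Finset.mem_filter.1 hi).1)
      refine this.imp ?_ ?_
      · rintro ⟨H, J, h1, h2, h3⟩
        exact ⟨H, J, h1, h2.trans (Finset.filter_subset _ _), h3⟩
      · rintro ⟨d, J, A, B, h1, h2⟩
        exact ⟨d, J, A, B, h1.trans (Finset.filter_subset _ _), h2⟩
    by_cases hzB : ∃ z ∉ B, n < (I.filter fun i => G.Adj z (b i)).card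
    · obtain ⟨z, hz, hcard⟩ := hzB
      have := restrict (fun i => G.Adj z (b i)) A (insert z B)
        (by rw [Finset.card_insert_of_notMem hz]; omega) hcard.le
        (fun x hx i hi => hA x hx i (Finset.mem_filter.1 hi).1)
        (fun x hx i hi => by
          rw [Finset.mem_filter] at hi
          rcases Finset.mem_insert.1 hx with rfl | hx
          · exact hi.2
          · exact hB x hx i hi.1)
      refine this.imp ?_ ?_
      · rintro ⟨H, J, h1, h2, h3⟩
        exact ⟨H, J, h1, h2.trans (Finset.filter_subset _ _), h3⟩
      · rintro ⟨d, J, A, B, h1, h2⟩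
        exact ⟨d, J, A, B, h1.trans (Finset.filter_subset _ _), h2⟩
    push Not at hzA hzB
    exact Or.inr ⟨n, I, A, B, Finset.Subset.refl _, hI.2, by omega, by omega, hA, hB, hzA, hzB⟩

-- By diameter two, `a i` lacks a common neighbour only with itself and its own neighbours; the
-- latter number at most `d` because `a i ∈ Z`. Hence `d + 1`.
open Classical in
theorem isSparse_image {V : Type*} {G : SimpleGraph V}
    (hG : ∀ u w, u ≠ w → ¬ G.Adj u w → ∃ z, G.Adj u z ∧ G.Adj z w)
    {a b : ℕ → V} {I : Finset ℕ} {Z : Set V} {d : ℕ}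
    (hZ : ∀ z ∈ Z, (I.filter fun i => G.Adj z (b i)).card ≤ d)
    (ha : ∀ i ∈ I, a i ∈ Z)
    (hlink : ∀ i ∈ I, ∀ j ∈ I, ∀ z, G.Adj (a i) z → G.Adj z (b j) → z ∈ Z) :
    IsSparse G Z (d + 1) (I.image a) (I.image b) := by
  have hadj : ∀ z ∈ Z, ((I.image b).filter fun y => G.Adj z y).card ≤ d := by
    intro z hz
    rw [Finset.filter_image]
    exact Finset.card_image_le.trans (hZ z hz)
  refine ⟨fun z hz => (hadj z hz).trans d.le_succ, ?_⟩
  intro x hx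
  obtain ⟨i, hi, rfl⟩ := Finset.mem_image.1 hx
  have hsub : ((I.image b).filter fun y => ¬ ∃ z ∈ Z, G.Adj (a i) z ∧ G.Adj z y) ⊆
      insert (a i) ((I.image b).filter fun y => G.Adj (a i) y) := by
    intro y hy
    rw [Finset.mem_filter] at hy
    obtain ⟨hyI, hy⟩ := hy
    rw [Finset.mem_insert, Finset.mem_filter]
    by_contra! hcon
    obtain ⟨z, h1, h2⟩ := hG (a i) y hcon.1.symm (hcon.2 hyI)
    obtain ⟨j, hj, rfl⟩ := Finset.mem_image.1 hyI
    exact hy ⟨z, hlink i hi j hj z h1 h2, h1, h2⟩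
  exact (Finset.card_le_card hsub).trans
    ((Finset.card_insert_le _ _).trans (Nat.add_le_add_right (hadj _ (ha i hi)) 1))

/-! ### Segments of a long path -/

theorem isChain_map_range {V : Type*} {R : V → V → Prop} (q : ℕ → V) (m : ℕ)
    (h : ∀ j < m, R (q j) (q (j + 1))) : ((List.range (m + 1)).map q).IsChain R := by
  induction m with
  | zero => simp
  | succ m ih =>
    rw [List.range_succ, List.map_append]
    refine (ih fun j hj => h j (by omega)).append (by simp) ?_
    intro x hx y hy
    simp only [List.range_succ, List.map_append, List.map_cons, List.map_nil,
      List.getLast?_append, List.getLast?_singleton, Option.some_or, Option.mem_def,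
      Option.some.injEq, List.head?_cons] at hx hy
    subst hx hy
    exact h m (by omega)

/-- A common neighbour of both ends of many disjoint segments of a path is rich in cycles. -/
theorem isCycleRich_of_segments {V : Type*} {G : SimpleGraph V} {p : ℕ → V} {n m f : ℕ}
    (hp : Set.InjOn p (Set.Iic (n * (m + 1)))) (hadj : ∀ j < n * (m + 1), G.Adj (p j) (p (j + 1)))
    {J : Finset ℕ} (hJn : ∀ i ∈ J, i < n) (hJ : f < J.card) {z : V}
    (h0 : ∀ i ∈ J, G.Adj z (p (i * (m + 1)))) (hm : ∀ i ∈ J, G.Adj z (p (i * (m + 1) + m))) :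
    IsCycleRich G (m + 2) f z := by
  intro F hzF hF
  have hlt : ∀ i ∈ J, ∀ j ≤ m, i * (m + 1) + j < n * (m + 1) := by
    intro i hi j hj
    have := Nat.mul_le_mul_right (m + 1) (hJn i hi)
    rw [Nat.succ_mul] at this
    omega
  -- Segments are disjoint, so `F` cannot meet all of the more than `f` segments.
  obtain ⟨i, hi, hiF⟩ : ∃ i ∈ J, ∀ j ≤ m, p (i * (m + 1) + j) ∉ F := by
    by_contra! hcon
    choose! j hj hjF using hcon
    refine absurd (Finset.card_le_card_of_injOn (fun i => p (i * (m + 1) + j i)) hjF ?_)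
      (by omega)
    intro i hi i' hi' heq
    have heq := hp (hlt i hi _ (hj i hi)).le (hlt i' hi' _ (hj i' hi')).le heq
    have e : ∀ i ∈ J, (i * (m + 1) + j i) / (m + 1) = i := fun i hi => by
      rw [mul_comm, Nat.mul_add_div (by omega), Nat.div_eq_of_lt (by have := hj i hi; omega),
        add_zero]
    rw [← e i hi, ← e i' hi', heq]
  refine ⟨(List.range (m + 1)).map fun j => p (i * (m + 1) + j), by simp, ?_, ?_, ?_⟩
  · refine List.Nodup.map_on ?_ List.nodup_range
    intro x hx y hy hxy
    rw [List.mem_range] at hx hy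
    have := hp (hlt i hi x (by omega)).le (hlt i hi y (by omega)).le hxy
    omega
  · intro x hx
    obtain ⟨j, hj, rfl⟩ := List.mem_map.1 hx
    exact hiF j (by rw [List.mem_range] at hj; omega)
  · have hch := isChain_map_range (R := G.Adj) (fun j => p (i * (m + 1) + j)) m
      fun j hj => hadj _ (hlt i hi j hj.le)
    rw [← List.cons_append]
    refine List.IsChain.append ?_ (by simp) ?_
    · rw [List.range_succ_eq_map, List.map_cons] at hch ⊢
      exact List.isChain_cons_cons.2 ⟨h0 i hi, hch⟩
    · intro x hx y hy
      rw [List.range_succ, List.map_append, ← List.cons_append] at hx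
      simp only [List.map_cons, List.map_nil, List.getLast?_append, List.getLast?_singleton,
        Option.some_or, Option.mem_def, Option.some.injEq, List.head?_cons] at hx hy
      subst hx hy
      exact (hm i hi).symm

theorem exists_common_neighbor_of_ediam_le_two {V : Type*} {G : SimpleGraph V}
    (hG : G.ediam ≤ 2) (u w : V) (huw : u ≠ w) (hadj : ¬ G.Adj u w) :
    ∃ z, G.Adj u z ∧ G.Adj z w := by
  have h2 : G.edist u w ≤ 2 := SimpleGraph.edist_le_ediam.trans hG
  obtain ⟨q, hq⟩ := SimpleGraph.exists_walk_of_edist_ne_top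
    (ne_top_of_le_ne_top (by simp) h2)
  rw [← hq] at h2
  have hlen : q.length ≤ 2 := by exact_mod_cast h2
  match q with
  | .nil => exact absurd rfl huw
  | .cons h .nil => exact absurd h hadj
  | .cons h (.cons h' .nil) => exact ⟨_, h, h'⟩
  | .cons h (.cons h' (.cons h'' r)) =>
    simp only [SimpleGraph.Walk.length_cons] at hlen
    omega

/-! ### From a long path to a rich vertex -/

/-- A long path in a graph of diameter two forces a vertex that is rich in cycles of length `2l`. -/
theorem exists_isCycleRich (l f : ℕ) (hl : 3 ≤ l) : ∃ N : ℕ, ∀ (V : Type*) (G : SimpleGraph V),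
    (∀ u w, u ≠ w → ¬ G.Adj u w → ∃ z, G.Adj u z ∧ G.Adj z w) →
    ∀ p : ℕ → V, Set.InjOn p (Set.Iic N) → (∀ j < N, G.Adj (p j) (p (j + 1))) →
      ∃ v, IsCycleRich G (2 * l) f v := by
  classical
  obtain ⟨t, ht⟩ : ∃ t, t = f + 2 * l + 1 := ⟨_, rfl⟩
  obtain ⟨n, hn⟩ := exists_hubs t
    -- The term `2 * (t * d) + 2 * t` pays for the indices deleted as `R1`, ..., `R4`.
    (fun d => IsSparse.bound (f + 2 * l) (d + 1) + (2 * (t * d) + 2 * t) + 1) (2 * t)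
  obtain ⟨m, hm⟩ : ∃ m, 2 * l = m + 2 := ⟨2 * l - 2, by omega⟩
  refine ⟨n * (m + 1), fun V G hG p hp hadj => ?_⟩
  let a : ℕ → V := fun i => p (i * (m + 1))
  let b : ℕ → V := fun i => p (i * (m + 1) + m)
  have hlt : ∀ i < n, i * (m + 1) + m < n * (m + 1) := by
    intro i hi
    have := Nat.mul_le_mul_right (m + 1) (show i + 1 ≤ n from hi)
    rw [Nat.succ_mul] at this
    omega
  have ha : ∀ i < n, ∀ j < n, a i = a j → i = j := by
    intro i hi j hj h
    have h1 := hlt i hi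
    have h2 := hlt j hj
    exact Nat.eq_of_mul_eq_mul_right m.succ_pos
      (hp (show i * (m + 1) ≤ n * (m + 1) by omega) (show j * (m + 1) ≤ n * (m + 1) by omega) h)
  have hb : ∀ i < n, ∀ j < n, b i = b j → i = j := by
    intro i hi j hj h
    have := hp (hlt i hi).le (hlt j hj).le h
    exact Nat.eq_of_mul_eq_mul_right m.succ_pos (Nat.add_right_cancel this)
  have card_image : ∀ (c : ℕ → V), (∀ i < n, ∀ j < n, c i = c j → i = j) →
      ∀ J : Finset ℕ, (∀ i ∈ J, i < n) → (J.image c).card = J.card := fun c hc J hJ =>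
    Finset.card_image_of_injOn fun i hi j hj h => hc i (hJ i hi) j (hJ j hj) h
  rcases hn V G a b (Finset.range n) ∅ ∅ (by simp) (by simp) (by simp) (by simp) with
    ⟨H, J, hH, hJn, hJ, hHJ⟩ | ⟨d, J, A, B, hJn, hJ, hAt, hBt, hA, hB, hA', hB'⟩
  · obtain ⟨v, hv⟩ := Finset.card_pos.1 (show 0 < H.card by omega)
    have hJn : ∀ i ∈ J, i < n := fun i hi => Finset.mem_range.1 (hJn hi)
    refine ⟨v, ?_⟩
    rcases hHJ with h | h
    · exact isCycleRich_of_complete (Y := J.image a) (by omega) (by omega)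
        (by rw [card_image a ha J hJn]; omega)
        (fun x hx y hy => by obtain ⟨i, hi, rfl⟩ := Finset.mem_image.1 hy; exact h x hx i hi) hv
    · exact isCycleRich_of_complete (Y := J.image b) (by omega) (by omega)
        (by rw [card_image b hb J hJn]; omega)
        (fun x hx y hy => by obtain ⟨i, hi, rfl⟩ := Finset.mem_image.1 hy; exact h x hx i hi) hv
  have hJn : ∀ i ∈ J, i < n := fun i hi => Finset.mem_range.1 (hJn hi)
  have hbound := IsSparse.le_bound (f + 2 * l) (d + 1)
  by_cases hAB : ∃ z ∈ A, z ∈ B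
  · obtain ⟨z, hzA, hzB⟩ := hAB
    exact ⟨z, hm ▸ isCycleRich_of_segments hp hadj hJn (by omega) (hA z hzA) (hB z hzB)⟩
  by_cases hAe : A = ∅
  · subst hAe
    have hsp : IsSparse G Set.univ (d + 1) (J.image a) (J.image a) :=
      isSparse_image hG (fun z _ => hA' z (by simp)) (fun _ _ => trivial)
        (fun _ _ _ _ _ _ _ => trivial)
    have hcard := card_image a ha J hJn
    obtain ⟨v, hv⟩ := Finset.card_pos.1 (show 0 < (J.image a).card by omega)
    exact ⟨v, hsp.isCycleRich hsp hl (by omega) (by omega) (Or.inr rfl) hv⟩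
  obtain ⟨v, hv⟩ := Finset.nonempty_iff_ne_empty.2 hAe
  have hBA : ∀ z ∈ B, z ∉ A := fun z hzB hzA => hAB ⟨z, hzA, hzB⟩
  -- After deleting these indices no hub is a common neighbour of some `a i` and some `b j`, and no
  -- chosen end is itself a hub, so all links run through `Z`.
  let R1 := B.biUnion fun z => J.filter fun i => G.Adj z (a i)
  let R2 := A.biUnion fun z => J.filter fun i => G.Adj z (b i)
  let R3 := J.filter fun i => a i ∈ B
  let R4 := J.filter fun i => b i ∈ A
  let K := J \ ((R1 ∪ R2) ∪ (R3 ∪ R4))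
  have hK : IsSparse.bound (f + 2 * l) (d + 1) < K.card := by
    have c1 : R1.card ≤ t * d := (Finset.card_biUnion_le_card_mul _ _ d fun z hz =>
      hA' z (hBA z hz)).trans (Nat.mul_le_mul_right d hBt)
    have c2 : R2.card ≤ t * d := (Finset.card_biUnion_le_card_mul _ _ d fun z hz =>
      hB' z fun hzB => hBA z hzB hz).trans (Nat.mul_le_mul_right d hAt)
    have c3 : R3.card ≤ t := (Finset.card_le_card_of_injOn a
      (fun i hi => (Finset.mem_filter.1 hi).2) (fun i hi j hj h =>
        ha i (hJn i (Finset.mem_filter.1 hi).1) j (hJn j (Finset.mem_filter.1 hj).1) h)).trans hBt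
    have c4 : R4.card ≤ t := (Finset.card_le_card_of_injOn b
      (fun i hi => (Finset.mem_filter.1 hi).2) (fun i hi j hj h =>
        hb i (hJn i (Finset.mem_filter.1 hi).1) j (hJn j (Finset.mem_filter.1 hj).1) h)).trans hAt
    have c5 := Finset.card_union_le (R1 ∪ R2) (R3 ∪ R4)
    have c6 := Finset.card_union_le R1 R2
    have c7 := Finset.card_union_le R3 R4
    have c8 : J.card ≤ K.card + _ := Finset.card_le_card_sdiff_add_card
    omega
  have hKJ : K ⊆ J := Finset.sdiff_subset
  have hKgood : ∀ i ∈ K, (∀ z ∈ B, ¬ G.Adj z (a i)) ∧ (∀ z ∈ A, ¬ G.Adj z (b i)) ∧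
      a i ∉ B ∧ b i ∉ A := by
    intro i hi
    have hiJ := hKJ hi
    have hi' := (Finset.mem_sdiff.1 hi).2
    simp only [Finset.mem_union, not_or] at hi'
    obtain ⟨⟨h1, h2⟩, h3, h4⟩ := hi'
    exact ⟨fun z hz h => h1 (Finset.mem_biUnion.2 ⟨z, hz, Finset.mem_filter.2 ⟨hiJ, h⟩⟩),
      fun z hz h => h2 (Finset.mem_biUnion.2 ⟨z, hz, Finset.mem_filter.2 ⟨hiJ, h⟩⟩),
      fun h => h3 (Finset.mem_filter.2 ⟨hiJ, h⟩), fun h => h4 (Finset.mem_filter.2 ⟨hiJ, h⟩)⟩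
  let Z : Set V := {z | z ∉ A ∧ z ∉ B}
  have haZ : ∀ i ∈ K, a i ∈ Z := fun i hi =>
    ⟨fun h => G.loopless.irrefl _ (hA _ h i (hKJ hi)), (hKgood i hi).2.2.1⟩
  have hbZ : ∀ i ∈ K, b i ∈ Z := fun i hi =>
    ⟨(hKgood i hi).2.2.2, fun h => G.loopless.irrefl _ (hB _ h i (hKJ hi))⟩
  have hlink : ∀ i ∈ K, ∀ j ∈ K, ∀ z, G.Adj (a i) z → G.Adj z (b j) → z ∈ Z :=
    fun i hi j hj z h1 h2 => ⟨fun h => (hKgood j hj).2.1 z h h2,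
      fun h => (hKgood i hi).1 z h h1.symm⟩
  have mono : ∀ P : ℕ → Prop, (K.filter P).card ≤ (J.filter P).card := fun P =>
    Finset.card_le_card (Finset.filter_subset_filter P hKJ)
  have hXY : IsSparse G Z (d + 1) (K.image a) (K.image b) :=
    isSparse_image hG (fun z hz => (mono _).trans (hB' z hz.2)) haZ hlink
  have hYX : IsSparse G Z (d + 1) (K.image b) (K.image a) :=
    isSparse_image hG (fun z hz => (mono _).trans (hA' z hz.1)) hbZ
      (fun i hi j hj z h1 h2 => hlink j hj i hi z h2.symm h1.symm)
  have hKn : ∀ i ∈ K, i < n := fun i hi => hJn i (hKJ hi)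
  rw [← card_image a ha K hKn] at hK
  have hK' := hK
  rw [card_image a ha K hKn, ← card_image b hb K hKn] at hK'
  -- For even `l` the alternating links close up by themselves; for odd `l` the hub `v ∈ A` closes
  -- them.
  rcases Nat.even_or_odd l with hpar | hpar
  · obtain ⟨x, hx⟩ := Finset.card_pos.1 (show 0 < (K.image a).card by omega)
    exact ⟨x, hXY.isCycleRich hYX hl hK hK' (Or.inl hpar) hx⟩
  · refine ⟨v, hXY.isCycleRich_of_hub hYX hK hK' hpar fun x hx => ?_⟩
    obtain ⟨i, hi, rfl⟩ := Finset.mem_image.1 hx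
    exact hA v hv i (hKJ hi)

theorem mainTheorem6 (l k : ℕ) (hl : 3 ≤ l) (hk : 1 ≤ k) :
    ∃ c : ℕ, ∀ (V : Type*) [Finite V] (G : SimpleGraph V),
      G.ediam ≤ 2 → (sharedVertexCycles k (2 * l)).Free G → treedepth G ≤ (c : ℕ∞) := by
  obtain ⟨N, hN⟩ := exists_isCycleRich l (k * (2 * l) + 1) hl
  refine ⟨N, fun V _ G hG hfree => treedepth_le_of_no_path G N ?_⟩
  rintro ⟨p, hp, hadj⟩
  obtain ⟨v, hv⟩ := hN V G (exists_common_neighbor_of_ediam_le_two hG) p hp hadj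
  exact hv.not_free (by omega) hfree
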